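/- Let $D$ be a digraph (loops allowed, no multiple arcs) on a finite or countably infinite vertex set, and suppose that $D$ is strong, i.e. for any two distinct vertices $v,w$ there is a directed path from $v$ to $w$. A directed cycle of length $n\ge 1$ is a cyclic sequence of $n$ distinct vertices in which each vertex is joined by an arc to the next one (a loop is a cycle of length $1$, a pair of opposite arcs a cycle of length $2$). Let $\ell_{\max}(D)\in\{0,1,2,\dots,\infty\}$ be the supremum of the lengths of the directed cycles of $D$. Let $|sct(D)|\in\{0,1,2,\dots,\infty\}$ be the smallest size of a cycle transversal of $D$, i.e. of a set of vertices whose removal leaves a digraph without directed cycles ($\infty$ if there is no finite one). A weighting of $D$ is a positive real function on its arcs. It is truthly substochastic if for each vertex the sum of the weights of the arcs leaving it is at most $1$, and this sum is strictly less than $1$ for at least one vertex. For a weighting $S$ and a finite (not necessarily induced) subdigraph $F$ of $D$, let $\lambda_S(F)$ be the spectral radius of the weighted adjacency matrix of $F$, and let $\lambda_S(D)$ be the supremum of $\lambda_S(F)$ over all finite strong subdigraphs $F$ of $D$. **Proposition 4.** The following are equivalent: 1. for every truthly substochastic weighting $S$ of $D$, $\inf_F\bigl(1-\lambda_S(F)\bigr)>0$,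 where $F$ runs over all finite subdigraphs of $D$; 2. for every truthly substochastic weighting $S$ of $D$, $\inf_F\bigl(1-\lambda_S(F)\bigr)>0$, where $F$ runs over all finite strong subdigraphs of $D$; 3. for every truthly substochastic weighting $S$ of $D$, $\lambda_S(D)<1$; 4. $|sct(D)|<\infty$ and $\ell_{\max}(D)<\infty$. -/

import Mathlib

open scoped ENNReal

namespace Digraph

variable {V : Type*}

/-- A digraph is strong if there is a path from `v` to `w` for all vertices `v ≠ w`
(for `v = w` the relation below holds trivially). -/
def IsStrong (D : Digraph V) : Prop :=
  ∀ v w : V, Relation.ReflTransGen D.Adj v w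

/-- A directed cycle of `D`, written as a cyclic sequence of distinct vertices
`v₀ → v₁ → ⋯ → v_k → v₀` (the addition in `Fin (k + 1)` is modulo `k + 1`).
The case `k = 0` is a loop, and `k = 1` is a pair of opposite arcs. -/
structure DirectedCycle (D : Digraph V) where
  /-- the number of arcs minus one -/
  k : ℕ
  vert : Fin (k + 1) → V
  vert_injective : Function.Injective vert
  adj : ∀ i, D.Adj (vert i) (vert (i + 1))

/-- The length of a directed cycle is the number of its arcs. -/
def DirectedCycle.length {D : Digraph V} (c : D.DirectedCycle) : ℕ := c.k + 1

/-- The length of a longest directed cycle; it is `⊤` if the lengths are unbounded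
(and `0` if there are no cycles). -/
noncomputable def maxCycleLength (D : Digraph V) : ℕ∞ :=
  ⨆ c : D.DirectedCycle, (c.length : ℕ∞)

/-- The digraph obtained by removing the vertices of `T` with all their incident arcs. -/
def deleteVerts (D : Digraph V) (T : Set V) : Digraph ↥(Tᶜ) where
  Adj v w := D.Adj v w

/-- `T` is a cycle transversal if the vertex-deleted digraph has no cycles. -/
def IsCycleTransversal (D : Digraph V) (T : Set V) : Prop :=
  IsEmpty (D.deleteVerts T).DirectedCycle

/-- The size of a smallest cycle transversal; it is `⊤` if no finite one exists. -/
noncomputable def sctSize (D : Digraph V) : ℕ∞ :=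
  ⨅ T : {T : Set V // D.IsCycleTransversal T}, (T : Set V).encard

/-- The arcs of a digraph. -/
def Arc (D : Digraph V) : Type _ := {a : V × V // D.Adj a.1 a.2}

/-- A weighting is a positive function on the arcs. -/
structure Weighting (D : Digraph V) where
  weight : D.Arc → ℝ
  pos : ∀ a, 0 < weight a

/-- A finite (not necessarily induced) subdigraph of `D`. -/
structure FiniteSubdigraph (D : Digraph V) where
  verts : Finset V
  Adj : V → V → Prop
  adj_sub : ∀ {v w}, Adj v w → D.Adj v w
  left_mem : ∀ {v w}, Adj v w → v ∈ verts
  right_mem : ∀ {v w}, Adj v w → w ∈ verts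

/-- A finite subdigraph as a digraph on its own vertex set. -/
def FiniteSubdigraph.toDigraph {D : Digraph V} (F : D.FiniteSubdigraph) :
    Digraph ↥F.verts where
  Adj v w := F.Adj v w

namespace Weighting

variable {D : Digraph V}

open Classical in
/-- The weighted adjacency matrix. -/
noncomputable def adjMatrix (W : D.Weighting) : Matrix V V ℝ :=
  Matrix.of fun v w => if h : D.Adj v w then W.weight ⟨(v, w), h⟩ else 0

/-- The restriction of a weighting of `D` to a finite subdigraph. -/
def restrict (W : D.Weighting) (F : D.FiniteSubdigraph) : F.toDigraph.Weighting where
  weight a := W.weight ⟨((a.1.1 : V), (a.1.2 : V)), F.adj_sub a.2⟩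
  pos _ := W.pos _

open Classical in
/-- The Perron root of a weighted finite digraph: the spectral radius (over `ℂ`) of its
weighted adjacency matrix. -/
noncomputable def perronRoot [Fintype V] (W : D.Weighting) : ℝ :=
  (spectralRadius ℂ (W.adjMatrix.map (algebraMap ℝ ℂ))).toReal

/-- `λ_W(F)` for a finite subdigraph `F` of `D`. -/
noncomputable def finRoot (W : D.Weighting) (F : D.FiniteSubdigraph) : ℝ :=
  (W.restrict F).perronRoot

/-- `λ_W(D)`: the supremum of the Perron roots of the finite strong subdigraphs of `D`. -/
noncomputable def supRoot (W : D.Weighting) : ℝ≥0∞ :=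
  ⨆ F : {F : D.FiniteSubdigraph // F.toDigraph.IsStrong}, ENNReal.ofReal (W.finRoot F)

/-- The out-weight of a vertex: the sum of the (positive) weights of the arcs leaving it,
as an element of `[0, ∞]`. -/
noncomputable def outWeight (W : D.Weighting) (v : V) : ℝ≥0∞ :=
  ∑' w, ENNReal.ofReal (W.adjMatrix v w)

/-- All out-weights are at most `1`. -/
def IsSubstochastic (W : D.Weighting) : Prop :=
  ∀ v, W.outWeight v ≤ 1

/-- All out-weights are at most `1` and at least one is strictly less than `1`. -/
def IsTruthlySubstochastic (W : D.Weighting) : Prop :=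
  W.IsSubstochastic ∧ ∃ v, W.outWeight v < 1

end Weighting

end Digraph

/-! Suppose `T` is a finite transversal and cycle lengths are bounded. A walk `p` avoiding `T`
repeats no vertex. Take a simple path from its end back to its start. Whenever that path jumps
backwards along `p`, the jump and the stretch of `p` it skips form a cycle: the stretch is bounded,
and the jump spends a vertex of `T`. Hence `p` has bounded length (`le_mul_card`). Read a truthly
substochastic weighting as a walk that may die. By strength, survival from each vertex eventually
drops below 1, uniformly on the finite set `T`. Every walk soon meets `T` or stops, so survival
after some `K` steps is at most some `c < 1` everywhere, and every Perron root is at most `c ^ (1 /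
K)` (`exists_finRoot_le`).

Conversely, if either bound fails, choose cycles one after another, each lying mostly outside the
earlier ones. Give arcs of the `n`-th cycle weight close to 1 at new vertices and tiny weight at old
ones. Row sums stay below 1, while the geometric means along the cycles tend to 1
(`exists_weighting_finRoot_near_one`). -/

namespace Digraph

variable {V : Type*}

/-! ### Walks avoiding a finite cycle transversal -/

/-- Any two vertices related by the reflexive-transitive closure of `r` are joined by a
simple path. -/
theorem exists_nodup_isChain_of_reflTransGen {r : V → V → Prop} {x y : V}
    (h : Relation.ReflTransGen r x y) :
    ∃ l : List V, (x :: l).Nodup ∧ (x :: l).IsChain r ∧ (x :: l).getLast? = some y := by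
  induction h using Relation.ReflTransGen.head_induction_on with
  | refl => exact ⟨[], by simp, by simp, by simp⟩
  | @head a c hac _ ih =>
    obtain ⟨l, hn, hc, hl⟩ := ih
    by_cases ha : a ∈ c :: l
    · obtain ⟨s, t, hst⟩ := List.append_of_mem ha
      rw [hst] at hn hc hl
      refine ⟨t, (List.nodup_append.1 hn).2.1, (List.isChain_append.1 hc).2.1, ?_⟩
      simpa [List.getLast?_append] using hl
    · refine ⟨c :: l, List.nodup_cons.2 ⟨ha, hn⟩, List.isChain_cons_cons.2 ⟨hac, hc⟩, ?_⟩
      rw [List.getLast?_cons_cons, hl]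

/-- A closed simple path is a directed cycle. -/
theorem exists_directedCycle_of_list (D : Digraph V) {x : V} {l : List V}
    (hn : (x :: l).Nodup) (hc : (x :: l).IsChain D.Adj)
    (hlast : ∀ y ∈ (x :: l).getLast?, D.Adj y x) :
    ∃ c : D.DirectedCycle, c.length = (x :: l).length ∧ ∀ i, c.vert i ∈ x :: l := by
  refine ⟨⟨l.length, fun i => (x :: l)[i.1]'(by simp [Nat.le_of_lt_succ i.2]), fun i j hij => ?_, fun i => ?_⟩,
    by simp [DirectedCycle.length], fun i => List.getElem_mem _⟩
  · exact Fin.ext ((List.Nodup.getElem_inj_iff hn).1 hij)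
  · by_cases hi : i = Fin.last _
    · subst hi
      have := hlast ((x :: l)[l.length]'(by simp)) (by simp [List.getLast?_eq_getElem?])
      simpa [Fin.last_add_one] using this
    · have h1 := Fin.val_add_one i
      rw [if_neg hi] at h1
      have h2 : i.1 + 1 < (x :: l).length := by
        have := (i + 1).2
        simp only [List.length_cons]; omega
      have := List.isChain_iff_getElem.1 hc i.1 h2
      simpa [h1] using this

theorem isCycleTransversal_iff {D : Digraph V} {T : Set V} :
    D.IsCycleTransversal T ↔ ∀ c : D.DirectedCycle, ∃ i, c.vert i ∈ T := by
  constructor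
  · intro h c
    by_contra! hc
    exact h.false ⟨c.k, fun i => ⟨c.vert i, hc i⟩,
      fun i j hij => c.vert_injective (congrArg Subtype.val hij), c.adj⟩
  · intro h
    refine ⟨fun c => ?_⟩
    obtain ⟨i, hi⟩ := h ⟨c.k, fun i => c.vert i,
      fun i j hij => c.vert_injective (Subtype.ext hij), c.adj⟩
    exact (c.vert i).2 hi

/-- The arcs of `D` that avoid `T`. -/
def AdjOff (D : Digraph V) (T : Set V) (v w : V) : Prop := D.Adj v w ∧ v ∉ T ∧ w ∉ T

theorem IsCycleTransversal.not_transGen {D : Digraph V} {T : Set V}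
    (hT : D.IsCycleTransversal T) (x : V) : ¬ Relation.TransGen (D.AdjOff T) x x := by
  intro h
  obtain ⟨y, hxy, hyx⟩ := (Relation.TransGen.head'_iff).1 h
  obtain ⟨l, hn, hc, hl⟩ := exists_nodup_isChain_of_reflTransGen hyx
  obtain ⟨c, -, hc'⟩ := D.exists_directedCycle_of_list hn (hc.imp fun _ _ h => h.1)
    (by rw [hl]; rintro z ⟨⟩; exact hxy.1)
  obtain ⟨i, hi⟩ := isCycleTransversal_iff.1 hT c
  -- The chain condition says nothing about a one-vertex path, so `y ∉ T` is supplied separately.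
  have key : ∀ z ∈ y :: l, z ∉ T := by
    have : ∀ (l : List V) (y : V), y ∉ T → (y :: l).IsChain (D.AdjOff T) →
        ∀ z ∈ y :: l, z ∉ T := by
      intro l
      induction l with
      | nil => intro y hy _ z hz; simp_all
      | cons a l ih =>
        intro y hy hc z hz
        rw [List.isChain_cons_cons] at hc
        rcases List.mem_cons.1 hz with rfl | hz
        · exact hy
        · exact ih a hc.1.2.2 hc.2 z hz
    exact this l y hxy.2.2 hc
  exact key _ (hc' i) hi

/-- A walk with `m` arcs avoiding `T`. -/
structure IsWalkOff (D : Digraph V) (T : Set V) (m : ℕ) (p : ℕ → V) : Prop where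
  notMem : ∀ i ≤ m, p i ∉ T
  adj : ∀ i < m, D.Adj (p i) (p (i + 1))

namespace IsWalkOff

variable {D : Digraph V} {T : Set V} {m : ℕ} {p : ℕ → V}

theorem reflTransGen (hp : D.IsWalkOff T m p) {i j : ℕ} (hij : i ≤ j) (hj : j ≤ m) :
    Relation.ReflTransGen (D.AdjOff T) (p i) (p j) := by
  induction j, hij using Nat.le_induction with
  | base => exact .refl
  | succ j hij ih =>
    exact (ih (by omega)).tail ⟨hp.adj j (by omega), hp.notMem j (by omega), hp.notMem _ hj⟩

theorem injOn (hp : D.IsWalkOff T m p) (hT : D.IsCycleTransversal T) {i j : ℕ}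
    (hi : i ≤ m) (hj : j ≤ m) (h : p i = p j) : i = j := by
  have key : ∀ i j, i < j → j ≤ m → p i ≠ p j := by
    intro i j hij hj h
    refine hT.not_transGen (p i) ?_
    have h1 := hp.reflTransGen (i := i + 1) (j := j) hij hj
    rw [← h] at h1
    exact Relation.TransGen.head'
      ⟨hp.adj i (by omega), hp.notMem i (by omega), hp.notMem _ (by omega)⟩ h1
  rcases lt_trichotomy i j with hij | hij | hij
  · exact absurd h (key i j hij hj)
  · exact hij
  · exact absurd h.symm (key j i hij hi)

open Classical in
/-- If a simple path leads from `p j` back to `p 0`, then each of its jumps backwards along `p`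
passes through `T` and closes a directed cycle; this bounds `j`. -/
theorem le_mul_countP (hp : D.IsWalkOff T m p) (hT : D.IsCycleTransversal T) {L : ℕ}
    (hL : ∀ c : D.DirectedCycle, c.length ≤ L + 1) (rest : List V) :
    ∀ (seg : List V) (j : ℕ), j ≤ m → (∀ x ∈ seg, ∀ i ≤ m, x ≠ p i) →
      (p j :: (seg ++ rest)).Nodup → (p j :: (seg ++ rest)).IsChain D.Adj →
      (p j :: (seg ++ rest)).getLast? = some (p 0) →
      j ≤ L * (seg ++ rest).countP (· ∈ T) := by
  -- Scan the return path: `p j` is the last vertex of `p` met, `seg` the part read since then (off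
  -- `p`), `rest` the part still unread.
  induction rest with
  | nil =>
    intro seg j hj hseg _ _ hl
    rw [List.append_nil] at hl ⊢
    rcases List.eq_nil_or_concat seg with rfl | ⟨s, a, rfl⟩
    · have : p j = p 0 := by simpa using hl
      rw [hp.injOn hT hj (Nat.zero_le _) this]
      exact Nat.zero_le _
    · rw [List.concat_eq_append, ← List.cons_append, List.getLast?_concat] at hl
      exact absurd (Option.some.inj hl) (hseg a (by simp) 0 (Nat.zero_le _))
  | cons y rest ih =>
    intro seg j hj hseg hn hc hl
    by_cases hy : ∃ i ≤ m, y = p i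
    · obtain ⟨i, hi, rfl⟩ := hy
      have hn' : (p i :: rest).Nodup := by
        have := (List.nodup_cons.1 hn).2
        exact (List.nodup_append.1 this).2.1
      rw [← List.cons_append] at hc hl
      obtain ⟨hc1, hc2, hc3⟩ := List.isChain_append.1 hc
      have hl' : (p i :: rest).getLast? = some (p 0) := by
        rwa [List.getLast?_append_of_ne_nil _ (by simp)] at hl
      have h1 := ih [] i hi (by simp) hn' hc2 hl'
      rw [List.nil_append] at h1
      have hcount : (seg ++ p i :: rest).countP (· ∈ T)
          = seg.countP (· ∈ T) + rest.countP (· ∈ T) := by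
        rw [List.countP_append, List.countP_cons_of_neg]
        simpa using hp.notMem i hi
      rw [hcount]
      -- Forward jumps cost nothing; only backward ones must be paid for by a vertex of `T`.
      rcases le_or_gt j i with hji | hij
      · exact (hji.trans h1).trans (Nat.mul_le_mul_left _ (by omega))
      · have hsegT : 0 < seg.countP (· ∈ T) := by
          rw [List.countP_pos_iff]
          by_contra! hno
          refine hT.not_transGen (p i) (Relation.TransGen.trans_right
            (hp.reflTransGen hij.le hj) ?_)
          have : ∀ (seg : List V) (a : V), a ∉ T → (∀ x ∈ seg, x ∉ T) →
              (a :: seg).IsChain D.Adj → (∀ x ∈ (a :: seg).getLast?, D.Adj x (p i)) →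
              Relation.TransGen (D.AdjOff T) a (p i) := by
            intro seg
            induction seg with
            | nil =>
              intro a ha _ _ h
              exact .single ⟨h a (by simp), ha, hp.notMem i hi⟩
            | cons b seg ih =>
              intro a ha hs hc h
              rw [List.isChain_cons_cons] at hc
              refine .head ⟨hc.1, ha, hs b (by simp)⟩ (ih b (hs b (by simp))
                (fun x hx => hs x (by simp [hx])) hc.2 ?_)
              simpa using h
          refine this seg (p j) (hp.notMem j hj) (by simpa using hno) hc1 ?_
          intro x hx
          exact hc3 x hx _ (by simp)
        -- The cycle `p i`, ..., `p j`, `seg` has `j - i + 1 + seg.length` vertices, at most `L +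
        -- 1`.
        have hcyc : j ≤ i + L := by
          obtain ⟨d, rfl⟩ : ∃ d, j = i + d + 1 := ⟨j - i - 1, by omega⟩
          have hrange : (List.range' i (d + 2)).map p
              = p i :: (List.range' (i + 1) (d + 1)).map p := by
            simp [List.range'_succ]
          have hrange' : (List.range' i (d + 2)).map p
              = (List.range' i (d + 1)).map p ++ [p (i + d + 1)] := by
            rw [List.range'_1_concat, List.map_append]
            simp [Nat.add_assoc]
          have hnp : ((List.range' i (d + 2)).map p).Nodup := by
            refine List.Nodup.map_on ?_ List.nodup_range'
            intro a ha b hb hab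
            rw [List.mem_range'_1] at ha hb
            exact hp.injOn hT (by omega) (by omega) hab
          have hcp : ((List.range' i (d + 2)).map p).IsChain D.Adj := by
            rw [List.isChain_map, List.isChain_iff_getElem]
            intro a ha
            simp only [List.length_range'] at ha
            simp only [List.getElem_range', one_mul]
            exact hp.adj _ (by omega)
          obtain ⟨c, hcl, -⟩ := D.exists_directedCycle_of_list (x := p i)
            (l := (List.range' (i + 1) (d + 1)).map p ++ seg) (by
              rw [← List.cons_append, ← hrange, List.nodup_append]
              refine ⟨hnp, ?_, ?_⟩
              · exact (List.nodup_append.1 (List.nodup_cons.1 hn).2).1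
              · intro a ha b hb hab
                obtain ⟨e, he, rfl⟩ := List.mem_map.1 ha
                rw [List.mem_range'_1] at he
                exact hseg b hb e (by omega) hab.symm) (by
              rw [← List.cons_append, ← hrange, List.isChain_append]
              refine ⟨hcp, hc1.tail, ?_⟩
              rw [hrange', List.getLast?_concat]
              rintro x ⟨⟩ y hy
              cases seg with
              | nil => simp at hy
              | cons b s =>
                simp only [List.head?_cons, Option.mem_def, Option.some.injEq] at hy
                exact hy ▸ (List.isChain_cons_cons.1 hc1).1) (by
              intro x hx
              refine hc3 x ?_ _ (by simp)
              rw [← List.cons_append, ← hrange, hrange', List.append_assoc] at hx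
              simpa [List.getLast?_append] using hx)
          have := hL c
          rw [hcl] at this
          simp at this
          omega
        calc j ≤ i + L := hcyc
          _ ≤ L * rest.countP (· ∈ T) + L * 1 := by omega
          _ = L * (1 + rest.countP (· ∈ T)) := by ring
          _ ≤ _ := Nat.mul_le_mul_left _ (by omega)
    · push Not at hy
      have := ih (seg ++ [y]) j hj (by
        intro x hx i hi
        rcases List.mem_append.1 hx with hx | hx
        · exact hseg x hx i hi
        · rw [List.mem_singleton.1 hx]; exact hy i hi)
      simp only [List.append_assoc, List.singleton_append] at this
      exact this hn hc hl

/-- In a strong digraph with bounded cycle lengths, the walks avoiding a finite cycle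
transversal have bounded length. -/
theorem le_mul_card {T : Finset V} (hD : D.IsStrong) (hp : D.IsWalkOff T m p)
    (hT : D.IsCycleTransversal (T : Set V)) {L : ℕ}
    (hL : ∀ c : D.DirectedCycle, c.length ≤ L + 1) : m ≤ L * T.card := by
  classical
  obtain ⟨l, hn, hc, hl⟩ := exists_nodup_isChain_of_reflTransGen (hD (p m) (p 0))
  refine (hp.le_mul_countP hT hL l [] m le_rfl (by simp) hn hc hl).trans
    (Nat.mul_le_mul_left _ ?_)
  rw [List.nil_append, List.countP_eq_length_filter,
    ← List.toFinset_card_of_nodup ((List.nodup_cons.1 hn).2.filter _)]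
  refine Finset.card_le_card fun x hx => ?_
  simp at hx
  exact hx.2

end IsWalkOff

end Digraph

/-! ### Survival probabilities and the upper bound on Perron roots -/

namespace Digraph

variable {V : Type*}

namespace Weighting

variable {D : Digraph V}

/-- The transition operator of a weighting on nonnegative functions. -/
noncomputable def transition (W : D.Weighting) (f : V → ℝ≥0∞) (v : V) : ℝ≥0∞ :=
  ∑' w, ENNReal.ofReal (W.adjMatrix v w) * f w

theorem adjMatrix_nonneg (W : D.Weighting) (v w : V) : 0 ≤ W.adjMatrix v w := by
  simp only [adjMatrix, Matrix.of_apply]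
  split_ifs
  · exact (W.pos _).le
  · exact le_rfl

theorem adjMatrix_pos (W : D.Weighting) {v w : V} (h : D.Adj v w) : 0 < W.adjMatrix v w := by
  simp only [adjMatrix, Matrix.of_apply, dif_pos h]
  exact W.pos _

theorem adjMatrix_eq_zero (W : D.Weighting) {v w : V} (h : ¬ D.Adj v w) :
    W.adjMatrix v w = 0 := by
  simp only [adjMatrix, Matrix.of_apply, dif_neg h]

theorem transition_mono (W : D.Weighting) : Monotone W.transition := fun _ _ h _ =>
  ENNReal.tsum_le_tsum fun w => mul_le_mul_right (h w) _

theorem transition_const_mul (W : D.Weighting) (a : ℝ≥0∞) (f : V → ℝ≥0∞) :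
    W.transition (fun w => a * f w) = fun v => a * W.transition f v := by
  funext v
  simp only [transition, ← ENNReal.tsum_mul_left]
  exact tsum_congr fun w => by ring

theorem transition_one (W : D.Weighting) : W.transition 1 = W.outWeight := by
  funext v
  simp [transition, outWeight]

/-- The probability of surviving `n` steps. -/
noncomputable def survival (W : D.Weighting) (n : ℕ) : V → ℝ≥0∞ := W.transition^[n] 1

theorem survival_succ (W : D.Weighting) (n : ℕ) :
    W.survival (n + 1) = W.transition (W.survival n) :=
  Function.iterate_succ_apply' _ _ _

theorem IsSubstochastic.survival_antitone {W : D.Weighting} (hW : W.IsSubstochastic) :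
    Antitone W.survival := by
  refine antitone_nat_of_succ_le fun n => ?_
  induction n with
  | zero => rw [survival_succ]; exact (congrArg (· ≤ (1 : V → ℝ≥0∞)) W.transition_one).mpr hW
  | succ n ih => rw [survival_succ W (n + 1)]; exact (W.transition_mono ih).trans_eq (W.survival_succ n).symm

theorem IsSubstochastic.survival_le_one {W : D.Weighting} (hW : W.IsSubstochastic) (n : ℕ)
    (v : V) : W.survival n v ≤ 1 :=
  hW.survival_antitone (Nat.zero_le n) v

/-- A loss at a vertex is felt one step later by each in-neighbour, since the joining arc has
positive weight; follow a path to a deficient vertex. -/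
theorem IsTruthlySubstochastic.exists_survival_lt_one {W : D.Weighting}
    (hW : W.IsTruthlySubstochastic) (hD : D.IsStrong) (v : V) : ∃ n, W.survival n v < 1 := by
  obtain ⟨hW, v₀, hv₀⟩ := hW
  induction hD v v₀ using Relation.ReflTransGen.head_induction_on with
  | refl => exact ⟨1, by simpa [survival, transition_one] using hv₀⟩
  | @head a c hac _ ih =>
    obtain ⟨n, hn⟩ := ih
    refine ⟨n + 1, ?_⟩
    rw [survival_succ]
    have hle : ∀ w, ENNReal.ofReal (W.adjMatrix a w) * W.survival n w
        ≤ ENNReal.ofReal (W.adjMatrix a w) := fun w =>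
      mul_le_of_le_one_right' (hW.survival_le_one n w)
    refine lt_of_lt_of_le (ENNReal.tsum_lt_tsum (i := c) ?_ hle ?_) (hW a)
    · exact ne_top_of_le_ne_top ENNReal.one_ne_top ((ENNReal.tsum_le_tsum hle).trans (hW a))
    · have := ENNReal.mul_lt_mul_right (a := ENNReal.ofReal (W.adjMatrix a c))
        (by simpa using W.adjMatrix_pos hac) ENNReal.ofReal_ne_top hn
      simpa using this

theorem exists_survival_le_on_finset {W : D.Weighting}
    (hW : W.IsTruthlySubstochastic) (hD : D.IsStrong) (T : Finset V) :
    ∃ N, ∃ c < 1, ∀ t ∈ T, W.survival N t ≤ c := by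
  classical
  induction T using Finset.induction_on with
  | empty => exact ⟨0, 0, by simp, by simp⟩
  | insert a T _ ih =>
    obtain ⟨N, c, hc, h⟩ := ih
    obtain ⟨n, hn⟩ := hW.exists_survival_lt_one hD a
    refine ⟨max N n, max c (W.survival n a), max_lt hc hn, fun t ht => ?_⟩
    rcases Finset.mem_insert.1 ht with rfl | ht
    · exact (hW.1.survival_antitone (le_max_right _ _) t).trans (le_max_right _ _)
    · exact (hW.1.survival_antitone (le_max_left _ _) t).trans ((h t ht).trans (le_max_left _ _))

/-- A uniform bound on survival after `N` steps on `T` extends to the vertices from which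
all walks reach `T` (or stop) after a bounded number of steps. -/
theorem IsSubstochastic.survival_le_of_no_walk {W : D.Weighting} (hW : W.IsSubstochastic)
    {T : Set V} {N : ℕ} {c : ℝ≥0∞} (hT : ∀ t ∈ T, W.survival N t ≤ c) (m : ℕ) :
    ∀ v, (∀ p : ℕ → V, p 0 = v → ¬ D.IsWalkOff T m p) → W.survival (N + m) v ≤ c := by
  induction m with
  | zero =>
    intro v hv
    refine hT v (by_contra fun h => hv (fun _ => v) rfl ⟨fun _ _ => h, by simp⟩)
  | succ m ih =>
    intro v hv
    by_cases hvT : v ∈ T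
    · exact (hW.survival_antitone (Nat.le_add_right _ _) v).trans (hT v hvT)
    rw [← Nat.add_assoc, survival_succ]
    have : ∀ w, ENNReal.ofReal (W.adjMatrix v w) * W.survival (N + m) w
        ≤ c * ENNReal.ofReal (W.adjMatrix v w) := by
      intro w
      by_cases h : D.Adj v w
      · rw [mul_comm]
        refine mul_le_mul_left (ih w fun p hp hpw => ?_) _
        -- Prepending `v` to a walk off `T` from `w` would give a forbidden longer walk from `v`.
        refine hv (fun n => Nat.casesOn n v p) rfl ⟨?_, ?_⟩
        · rintro (_ | i) hi
          · exact hvT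
          · exact hpw.notMem i (by omega)
        · rintro (_ | i) hi
          · simpa [hp] using h
          · exact hpw.adj i (by omega)
      · simp [W.adjMatrix_eq_zero h]
    refine (ENNReal.tsum_le_tsum this).trans ?_
    rw [ENNReal.tsum_mul_left]
    exact mul_le_of_le_one_right' (hW v)

/-- Let `g` be the modulus of an eigenvector, extended by zero. Then `‖z‖ * g ≤ W.transition g` and
`g` is at most its maximum; iterate `K` times and evaluate where the maximum is attained. -/
theorem enorm_pow_le_of_mem_spectrum (W : D.Weighting) (F : D.FiniteSubdigraph)
    [DecidableEq F.verts] {z : ℂ}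
    (hz : z ∈ spectrum ℂ ((W.restrict F).adjMatrix.map (algebraMap ℝ ℂ))) {K : ℕ} {c : ℝ≥0∞}
    (hc : ∀ v, W.survival K v ≤ c) : (‖z‖₊ : ℝ≥0∞) ^ K ≤ c := by
  classical
  set A := (W.restrict F).adjMatrix with hA
  rw [spectrum.mem_iff, Matrix.isUnit_iff_isUnit_det, isUnit_iff_ne_zero, not_not,
    ← Matrix.exists_mulVec_eq_zero_iff] at hz
  obtain ⟨f, hf0, hf⟩ := hz
  have heig : ∀ v, z * f v = ∑ w, (A v w : ℂ) * f w := by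
    intro v
    have h := congrFun hf v
    rw [Matrix.sub_mulVec, Pi.sub_apply, Pi.zero_apply, sub_eq_zero, Matrix.algebraMap_eq_diagonal,
      Matrix.mulVec_diagonal] at h
    simpa [Matrix.mulVec, dotProduct] using h
  have hne : Nonempty ↥F.verts := by
    by_contra h
    rw [not_nonempty_iff] at h
    exact hf0 (Subsingleton.elim _ _)
  obtain ⟨v₀, hv₀⟩ := Finite.exists_max fun v => ‖f v‖₊
  have hpos : 0 < ‖f v₀‖₊ := by
    obtain ⟨w, hw⟩ := Function.ne_iff.1 hf0
    exact lt_of_lt_of_le (by simpa using hw) (hv₀ w)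
  set g : V → ℝ≥0∞ := fun v => if h : v ∈ F.verts then (‖f ⟨v, h⟩‖₊ : ℝ≥0∞) else 0 with hg
  have hAle : ∀ v w : F.verts, A v w ≤ W.adjMatrix v w := by
    intro v w
    by_cases h : F.toDigraph.Adj v w
    · have h' : D.Adj v w := F.adj_sub h
      simp only [hA, adjMatrix, Matrix.of_apply, dif_pos h, dif_pos h', restrict]
      exact le_rfl
    · rw [hA, adjMatrix_eq_zero _ h]
      exact W.adjMatrix_nonneg _ _
  have hstep : ∀ v, (‖z‖₊ : ℝ≥0∞) * g v ≤ W.transition g v := by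
    intro v
    by_cases hv : v ∈ F.verts
    · simp only [hg, dif_pos hv]
      rw [← ENNReal.coe_mul, ← nnnorm_mul, heig]
      calc ((‖∑ w, (A ⟨v, hv⟩ w : ℂ) * f w‖₊ : NNReal) : ℝ≥0∞)
          ≤ ((∑ w, ‖(A ⟨v, hv⟩ w : ℂ) * f w‖₊ : NNReal) : ℝ≥0∞) :=
            ENNReal.coe_le_coe.2 (nnnorm_sum_le _ _)
        _ = ∑ w : F.verts, ENNReal.ofReal (A ⟨v, hv⟩ w) * g w := by
            rw [ENNReal.ofNNReal_finsetSum]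
            refine Finset.sum_congr rfl fun w _ => ?_
            rw [nnnorm_mul, ENNReal.coe_mul]
            congr 1
            · rw [Complex.nnnorm_real, ← enorm_eq_nnnorm,
                Real.enorm_of_nonneg (adjMatrix_nonneg _ _ _)]
            · simp [hg]
        _ ≤ ∑ w : F.verts, ENNReal.ofReal (W.adjMatrix v w) * g w :=
            Finset.sum_le_sum fun w _ =>
              mul_le_mul_left (ENNReal.ofReal_le_ofReal (hAle ⟨v, hv⟩ w)) _
        _ = ∑ w ∈ F.verts, ENNReal.ofReal (W.adjMatrix v w) * g w :=
            Finset.sum_coe_sort F.verts fun w => ENNReal.ofReal (W.adjMatrix v w) * g w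
        _ ≤ W.transition g v := ENNReal.sum_le_tsum _
    · simp [hg, hv]
  have hg1 : ∀ v, g v ≤ (‖f v₀‖₊ : ℝ≥0∞) * (1 : V → ℝ≥0∞) v := by
    intro v
    by_cases hv : v ∈ F.verts
    · simpa [hg, hv] using hv₀ ⟨v, hv⟩
    · simp [hg, hv]
  have hiter : ∀ n v, (‖z‖₊ : ℝ≥0∞) ^ n * g v ≤ (‖f v₀‖₊ : ℝ≥0∞) * W.survival n v := by
    intro n
    induction n with
    | zero => simpa [survival] using hg1
    | succ n ih =>
      intro v
      calc (‖z‖₊ : ℝ≥0∞) ^ (n + 1) * g v = (‖z‖₊ : ℝ≥0∞) ^ n * (‖z‖₊ * g v) := by ring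
        _ ≤ (‖z‖₊ : ℝ≥0∞) ^ n * W.transition g v := mul_le_mul_right (hstep v) _
        _ = W.transition (fun w => (‖z‖₊ : ℝ≥0∞) ^ n * g w) v := by rw [transition_const_mul]
        _ ≤ W.transition (fun w => (‖f v₀‖₊ : ℝ≥0∞) * W.survival n w) v :=
            W.transition_mono ih v
        _ = _ := by rw [transition_const_mul, survival_succ]
  have h := (hiter K v₀).trans (mul_le_mul_right (hc v₀) _)
  simp only [hg, v₀.2, dif_pos] at h
  rw [mul_comm] at h
  exact (ENNReal.mul_le_mul_iff_right (by simpa using hpos.ne') ENNReal.coe_ne_top).1 h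

/-- If the survival probability after `K` steps is uniformly less than one, then the Perron roots
of the finite subdigraphs are uniformly less than one. -/
theorem exists_finRoot_le (W : D.Weighting) {K : ℕ} (hK : K ≠ 0) {c : ℝ≥0∞} (hc1 : c < 1)
    (hc : ∀ v, W.survival K v ≤ c) : ∃ r : ℝ, r < 1 ∧ ∀ F, W.finRoot F ≤ r := by
  have hr : c ^ (K⁻¹ : ℝ) < 1 := ENNReal.rpow_lt_one hc1 (by positivity)
  refine ⟨(c ^ (K⁻¹ : ℝ)).toReal, ?_, fun F => ?_⟩
  · simpa using ENNReal.toReal_strict_mono ENNReal.one_ne_top hr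
  · let _ : DecidableEq F.verts := fun a b => Classical.propDecidable (a = b)
    refine ENNReal.toReal_mono hr.ne_top (iSup₂_le fun z hz => ?_)
    rw [ENNReal.le_rpow_inv_iff (by positivity), ENNReal.rpow_natCast]
    exact W.enorm_pow_le_of_mem_spectrum F hz hc

/-- Finiteness matters because `perronRoot` uses `toReal`, which sends `⊤` to 0. -/
theorem IsSubstochastic.spectralRadius_ne_top {W : D.Weighting} (hW : W.IsSubstochastic)
    (F : D.FiniteSubdigraph) [DecidableEq F.verts] :
    spectralRadius ℂ ((W.restrict F).adjMatrix.map (algebraMap ℝ ℂ)) ≠ ⊤ := by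
  refine ne_top_of_le_ne_top ENNReal.one_ne_top (iSup₂_le fun z hz => ?_)
  simpa using W.enorm_pow_le_of_mem_spectrum F hz (hW.survival_le_one 1)

theorem IsTruthlySubstochastic.exists_finRoot_le {W : D.Weighting}
    (hW : W.IsTruthlySubstochastic) (hD : D.IsStrong) (hsct : D.sctSize < ⊤)
    (hlen : D.maxCycleLength < ⊤) : ∃ r : ℝ, r < 1 ∧ ∀ F, W.finRoot F ≤ r := by
  obtain ⟨⟨T, hT⟩, hTfin⟩ := iInf_lt_iff.1 hsct
  have hTfin : T.Finite := Set.encard_lt_top_iff.1 hTfin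
  lift T to Finset V using hTfin
  obtain ⟨L, hL⟩ := ENat.ne_top_iff_exists.1 hlen.ne
  have hL' : ∀ c : D.DirectedCycle, c.length ≤ L + 1 := by
    intro c
    have : (c.length : ℕ∞) ≤ L := hL ▸ le_iSup (fun c : D.DirectedCycle => (c.length : ℕ∞)) c
    exact (Nat.cast_le.1 this).trans (Nat.le_succ _)
  obtain ⟨N, c, hc1, hc⟩ := exists_survival_le_on_finset hW hD T
  -- Walks off `T` have at most `L * T.card` arcs, so none has one more; `N` further steps then give
  -- the loss.
  refine W.exists_finRoot_le (K := N + (L * T.card + 1)) (by omega) hc1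
    fun v => hW.1.survival_le_of_no_walk (T := T) hc _ v fun p _ hp => ?_
  have := hp.le_mul_card hD hT hL'
  omega

end Weighting

end Digraph

/-! ### Perron roots of weighted cycles -/

namespace Digraph

variable {V : Type*}

open scoped Matrix in
/-- A matrix which acts as a weighted cyclic shift on some of the basis vectors: the product of
the weights is an eigenvalue of its power. -/
theorem prod_mem_spectrum_pow_of_cyclic {n : Type*} [Fintype n] [DecidableEq n] {k : ℕ}
    (A : Matrix n n ℂ) (u : Fin (k + 1) → n) (w : Fin (k + 1) → ℂ)
    (hA : ∀ i x, A (u i) x = if x = u (i + 1) then w i else 0) :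
    ∏ i, w i ∈ spectrum ℂ (A ^ (k + 1)) := by
  -- Only rows are prescribed, so row vectors are used: after `k + 1` shifts the one at `u 0`
  -- returns as a left eigenvector.
  have hrow : ∀ i, Pi.single (u i) 1 ᵥ* A = w i • Pi.single (u (i + 1)) (1 : ℂ) := by
    intro i
    funext x
    rw [Matrix.single_one_vecMul, Matrix.row_apply, hA, Pi.smul_apply, Pi.single_apply]
    simp
  have hpow : ∀ m : ℕ, Pi.single (u 0) 1 ᵥ* A ^ m
      = (∏ j ∈ Finset.range m, w (Fin.ofNat (k + 1) j)) •
        Pi.single (u (Fin.ofNat (k + 1) m)) (1 : ℂ) := by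
    intro m
    induction m with
    | zero => simp
    | succ m ih =>
      have hs : Fin.ofNat (k + 1) m + 1 = Fin.ofNat (k + 1) (m + 1) := by
        ext; simp [Fin.val_add, Fin.ofNat]
      rw [pow_succ, ← Matrix.vecMul_vecMul, ih, Matrix.smul_vecMul, hrow, hs, smul_smul,
        Finset.prod_range_succ]
  have hfin := hpow (k + 1)
  have h0 : Fin.ofNat (k + 1) (k + 1) = 0 := by ext; simp [Fin.ofNat]
  have hprod : ∏ j ∈ Finset.range (k + 1), w (Fin.ofNat (k + 1) j) = ∏ i, w i := by
    rw [Finset.prod_range]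
    refine Finset.prod_congr rfl fun i _ => congrArg w ?_
    ext; simp [Fin.ofNat, Nat.le_of_lt_succ i.2]
  rw [h0, hprod] at hfin
  rw [spectrum.mem_iff]
  intro hu
  obtain ⟨B, hB⟩ := hu.exists_right_inv
  have hz : Pi.single (u 0) (1 : ℂ) ᵥ* (algebraMap ℂ (Matrix n n ℂ) (∏ i, w i) - A ^ (k + 1))
      = 0 := by
    rw [Matrix.vecMul_sub, hfin, Algebra.algebraMap_eq_smul_one, Matrix.vecMul_smul,
      Matrix.vecMul_one, sub_self]
  have h1 : Pi.single (u 0) (1 : ℂ) = (0 : n → ℂ) := by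
    rw [← Matrix.vecMul_one (Pi.single (u 0) (1 : ℂ)), ← hB, ← Matrix.vecMul_vecMul, hz,
      Matrix.zero_vecMul]
  simpa using congrFun h1 (u 0)

namespace DirectedCycle

variable {D : Digraph V}

open Classical in
/-- The finite subdigraph formed by the vertices and arcs of a directed cycle. -/
noncomputable def subdigraph (c : D.DirectedCycle) : D.FiniteSubdigraph where
  verts := Finset.univ.image c.vert
  Adj v w := ∃ i, c.vert i = v ∧ c.vert (i + 1) = w
  adj_sub := by rintro v w ⟨i, rfl, rfl⟩; exact c.adj i
  left_mem := by rintro v w ⟨i, rfl, rfl⟩; exact Finset.mem_image_of_mem _ (Finset.mem_univ _)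
  right_mem := by rintro v w ⟨i, rfl, rfl⟩; exact Finset.mem_image_of_mem _ (Finset.mem_univ _)

theorem vert_mem_subdigraph (c : D.DirectedCycle) (i : Fin (c.k + 1)) :
    c.vert i ∈ c.subdigraph.verts := by
  classical
  exact Finset.mem_image_of_mem _ (Finset.mem_univ _)

theorem exists_vert_eq (c : D.DirectedCycle) {v : V} (hv : v ∈ c.subdigraph.verts) :
    ∃ i, c.vert i = v := by
  classical
  obtain ⟨i, -, rfl⟩ := Finset.mem_image.1 hv
  exact ⟨i, rfl⟩

theorem subdigraph_isStrong (c : D.DirectedCycle) : c.subdigraph.toDigraph.IsStrong := by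
  set u : Fin (c.k + 1) → c.subdigraph.verts := fun i => ⟨c.vert i, c.vert_mem_subdigraph i⟩
  have hadj : ∀ i, c.subdigraph.toDigraph.Adj (u i) (u (i + 1)) := fun i => ⟨i, rfl, rfl⟩
  have hfrom : ∀ j, Relation.ReflTransGen c.subdigraph.toDigraph.Adj (u 0) (u j) := by
    intro j
    induction j using Fin.induction with
    | zero => exact .refl
    | succ i ih => exact ih.tail (by simpa using hadj i.castSucc)
  have hto : ∀ j, Relation.ReflTransGen c.subdigraph.toDigraph.Adj (u j) (u 0) := by
    intro j
    induction j using Fin.reverseInduction with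
    | last => exact .single (by simpa using hadj (Fin.last _))
    | cast i ih => exact .head (by simpa using hadj i.castSucc) ih
  rintro ⟨v, hv⟩ ⟨w, hw⟩
  obtain ⟨i, rfl⟩ := c.exists_vert_eq hv
  obtain ⟨j, rfl⟩ := c.exists_vert_eq hw
  exact (hto i).trans (hfrom j)

/-- The Perron root of a directed cycle is at least the geometric mean of its weights. -/
theorem le_finRoot_subdigraph (c : D.DirectedCycle) {W : D.Weighting}
    (hW : W.IsSubstochastic) {q : ℝ}
    (h : q ^ c.length ≤ ∏ i, W.adjMatrix (c.vert i) (c.vert (i + 1))) :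
    q ≤ W.finRoot c.subdigraph := by
  let _ : DecidableEq c.subdigraph.verts := fun a b => Classical.propDecidable (a = b)
  set A := (W.restrict c.subdigraph).adjMatrix with hA
  have hmem := prod_mem_spectrum_pow_of_cyclic (A.map (algebraMap ℝ ℂ))
    (fun i => (⟨c.vert i, c.vert_mem_subdigraph i⟩ : c.subdigraph.verts))
    (fun i => (W.adjMatrix (c.vert i) (c.vert (i + 1)) : ℂ)) (by
      rintro i ⟨x, hx⟩
      have hiff : c.subdigraph.toDigraph.Adj ⟨c.vert i, c.vert_mem_subdigraph i⟩ ⟨x, hx⟩ ↔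
          x = c.vert (i + 1) := by
        constructor
        · rintro ⟨j, hj, rfl⟩
          rw [c.vert_injective hj]
        · rintro rfl
          exact ⟨i, rfl, rfl⟩
      rw [Matrix.map_apply]
      by_cases hxi : x = c.vert (i + 1)
      · subst hxi
        rw [if_pos rfl]
        simp only [hA, Weighting.adjMatrix, Matrix.of_apply, dif_pos (hiff.2 rfl),
          dif_pos (c.adj i)]
        rfl
      · rw [if_neg (by simpa using hxi), hA, Weighting.adjMatrix_eq_zero _ (mt hiff.1 hxi)]
        simp)
  -- By spectral mapping the product of the weights is `z ^ c.length` for some eigenvalue `z`.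
  rw [spectrum.map_pow_of_pos _ (Nat.succ_pos _)] at hmem
  obtain ⟨z, hz, hzp⟩ := hmem
  have hq : q ^ c.length ≤ ‖z‖ ^ c.length := by
    refine h.trans (le_of_eq ?_)
    rw [← norm_pow, show z ^ c.length = _ from hzp, ← Complex.ofReal_prod, Complex.norm_real,
      Real.norm_of_nonneg (Finset.prod_nonneg fun i _ => W.adjMatrix_nonneg _ _)]
  refine (le_of_pow_le_pow_left₀ (Nat.succ_ne_zero _) (norm_nonneg z) hq).trans ?_
  exact ENNReal.toReal_mono (hW.spectralRadius_ne_top c.subdigraph)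
    (le_iSup₂ (f := fun (z : ℂ) (_ : z ∈ spectrum ℂ (A.map (algebraMap ℝ ℂ))) =>
      (‖z‖₊ : ℝ≥0∞)) z hz)

end DirectedCycle

end Digraph

/-! ### A weighting whose Perron roots approach 1 -/

namespace Digraph

variable {V : Type*} {D : Digraph V}

/-- If there is no finite cycle transversal or the cycle lengths are unbounded, then some cycle
lies mostly outside any given finite set. -/
theorem exists_directedCycle_mul_card_le [DecidableEq V]
    (h : ¬ (D.sctSize < ⊤ ∧ D.maxCycleLength < ⊤)) (k : ℕ) (U : Finset V) :
    ∃ c : D.DirectedCycle, k * (Finset.univ.filter fun i => c.vert i ∈ U).card ≤ c.length := by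
  by_cases hs : D.sctSize < ⊤
  -- A cycle longer than `k * U.card` suffices, as it meets `U` at most `U.card` times.
  · have hl : D.maxCycleLength = ⊤ := not_lt_top_iff.1 fun hl => h ⟨hs, hl⟩
    have hlt : ((k * U.card : ℕ) : ℕ∞) < D.maxCycleLength := hl ▸ ENat.natCast_lt_top _
    obtain ⟨c, hc⟩ := lt_iSup_iff.1 hlt
    refine ⟨c, le_trans (Nat.mul_le_mul_left _ ?_) (Nat.cast_lt.1 hc).le⟩
    refine Finset.card_le_card_of_injOn c.vert (fun i hi => ?_) c.vert_injective.injOn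
    simpa using hi
  · have hU : ¬ D.IsCycleTransversal (U : Set V) := fun hU =>
      hs ((iInf_le (fun T : {T : Set V // D.IsCycleTransversal T} => (T : Set V).encard)
        ⟨U, hU⟩).trans_lt (Set.encard_lt_top_iff.2 U.finite_toSet))
    rw [isCycleTransversal_iff] at hU
    push Not at hU
    obtain ⟨c, hc⟩ := hU
    refine ⟨c, ?_⟩
    rw [Finset.filter_false_of_mem (fun i _ => by simpa using hc i)]
    simp

/-- On a countable set, there is a positive function of total mass less than one which dominates
prescribed values of total mass less than one. -/
theorem exists_pos_tsum_lt_one [Countable V] (s : ℕ → V) (a : ℕ → ℝ≥0∞) (ha : ∑' n, a n < 1) :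
    ∃ r : V → ℝ≥0∞, (∀ w, 0 < r w) ∧ ∑' w, r w < 1 ∧ ∀ n, a n ≤ r (s n) := by
  classical
  obtain ⟨β, hβ, hsum⟩ := ENNReal.exists_pos_sum_of_countable (tsub_pos_of_lt ha).ne' V
  refine ⟨fun w => β w + ∑' n, if w = s n then a n else 0, fun w => ?_, ?_, fun n => ?_⟩
  · exact lt_of_lt_of_le (by exact_mod_cast hβ w) le_self_add
  · rw [ENNReal.tsum_add, ENNReal.tsum_comm]
    simp only [tsum_ite_eq]
    exact lt_tsub_iff_right.1 hsum
  · refine le_trans ?_ le_add_self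
    refine le_trans (by simp) (ENNReal.le_tsum n)

theorem one_sub_add_half_lt_one {h : ℝ≥0∞} (h0 : h ≠ 0) (h1 : h ≤ 1) : 1 - h + h / 2 < 1 := by
  have ht : h ≠ ⊤ := ne_top_of_le_ne_top ENNReal.one_ne_top h1
  calc 1 - h + h / 2 < 1 - h + h :=
        ENNReal.add_lt_add_left (by simp) (ENNReal.half_lt_self h0 ht)
    _ = 1 := tsub_add_cancel_of_le h1

open Classical in
/-- The weight given by the `n`-th cycle to the arc leaving a vertex, which depends on whether
the vertex lies on an earlier cycle. -/
noncomputable def cycleArcWeight (old : Prop) (n : ℕ) : ℝ≥0∞ :=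
  if old then 4⁻¹ ^ (n + 1) else 1 - 2⁻¹ ^ (n + 1)

-- Only the first cycle `n₀` through a vertex has large weight there, leaving a gap `2⁻¹ ^ (n₀ +
-- 1)`; all later ones together use at most half of it.
open Classical in
theorem tsum_cycleArcWeight_lt_one (P : ℕ → Prop) :
    ∑' n, (if P n then cycleArcWeight (∃ m < n, P m) n else 0) < 1 := by
  by_cases hP : ∃ n, P n
  · set n₀ := Nat.find hP
    have hle : ∀ n, (if P n then cycleArcWeight (∃ m < n, P m) n else 0)
        ≤ (if n = n₀ then 1 - 2⁻¹ ^ (n₀ + 1) else 0) + 2⁻¹ ^ (n₀ + 2) * 2⁻¹ ^ (n + 1) := by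
      intro n
      rcases lt_trichotomy n n₀ with hn | hn | hn
      · rw [if_neg (Nat.find_min hP hn)]
        exact zero_le
      · subst hn
        refine le_trans ?_ le_self_add
        rw [if_pos rfl, if_pos (Nat.find_spec hP), cycleArcWeight, if_neg]
        rintro ⟨m, hm, h⟩
        exact Nat.find_min hP hm h
      · refine le_trans ?_ le_add_self
        split_ifs
        · rw [cycleArcWeight, if_pos ⟨n₀, hn, Nat.find_spec hP⟩]
          have h4 : (4⁻¹ : ℝ≥0∞) = 2⁻¹ * 2⁻¹ := by
            rw [← ENNReal.mul_inv (by simp) (by simp)]; norm_num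
          rw [h4, mul_pow]
          refine mul_le_mul_left ?_ _
          exact pow_le_pow_of_le_one zero_le (by simp) (by omega)
        · exact zero_le
    refine (ENNReal.tsum_le_tsum hle).trans_lt ?_
    rw [ENNReal.tsum_add, tsum_ite_eq, ENNReal.tsum_mul_left, ENNReal.tsum_geometric_add_one,
      ENNReal.one_sub_inv_two, inv_inv, ENNReal.inv_mul_cancel (by simp) (by simp), mul_one,
      pow_succ 2⁻¹ (n₀ + 1), ← div_eq_mul_inv]
    exact one_sub_add_half_lt_one (by simp) (pow_le_one₀ zero_le (by simp))
  · push Not at hP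
    simp [hP]

/-- A family of cycles determines a truthly substochastic weighting. -/
theorem exists_weighting_of_cycles [Countable V] [Nonempty V] (c : ℕ → D.DirectedCycle) :
    ∃ W : D.Weighting, W.IsTruthlySubstochastic ∧ ∀ n i,
      (cycleArcWeight (∃ m < n, (c n).vert i ∈ Set.range (c m).vert) n).toReal
        ≤ W.adjMatrix ((c n).vert i) ((c n).vert (i + 1)) := by
  classical
  have hrow : ∀ v, ∃ r : V → ℝ≥0∞, (∀ w, 0 < r w) ∧ ∑' w, r w < 1 ∧
      ∀ n i, (c n).vert i = v →
        cycleArcWeight (∃ m < n, v ∈ Set.range (c m).vert) n ≤ r ((c n).vert (i + 1)) := by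
    intro v
    obtain ⟨r, h0, h1, h2⟩ := exists_pos_tsum_lt_one
      -- The successor of `v` on the `n`-th cycle; the default `v` is harmless, its prescribed mass
      -- being 0.
      (fun n => if h : v ∈ Set.range (c n).vert then (c n).vert (h.choose + 1) else v) _
      (tsum_cycleArcWeight_lt_one fun n => v ∈ Set.range (c n).vert)
    refine ⟨r, h0, h1, ?_⟩
    rintro n i rfl
    have hmem : (c n).vert i ∈ Set.range (c n).vert := ⟨i, rfl⟩
    have := h2 n
    rwa [if_pos hmem, dif_pos hmem, (c n).vert_injective hmem.choose_spec] at this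
  choose r hpos hsum hr using hrow
  have hfin : ∀ v w, r v w ≠ ⊤ := fun v w =>
    ((ENNReal.le_tsum w).trans_lt (hsum v)).ne_top
  set W : D.Weighting := ⟨fun a => (r a.1.1 a.1.2).toReal,
    fun a => ENNReal.toReal_pos (hpos _ _).ne' (hfin _ _)⟩ with hW
  have hadj : ∀ {v w}, D.Adj v w → W.adjMatrix v w = (r v w).toReal := by
    intro v w h
    simp only [Weighting.adjMatrix, Matrix.of_apply, dif_pos h, hW]
  have hout : ∀ v, W.outWeight v < 1 := by
    intro v
    refine lt_of_le_of_lt (ENNReal.tsum_le_tsum fun w => ?_) (hsum v)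
    by_cases h : D.Adj v w
    · rw [hadj h, ENNReal.ofReal_toReal (hfin v w)]
    · simp [W.adjMatrix_eq_zero h]
  refine ⟨W, ⟨fun v => (hout v).le, Classical.arbitrary V, hout _⟩, fun n i => ?_⟩
  rw [hadj ((c n).adj i)]
  exact ENNReal.toReal_mono (hfin _ _) (hr _ n i rfl)

theorem exists_weighting_finRoot_near_one [Countable V]
    (h : ¬ (D.sctSize < ⊤ ∧ D.maxCycleLength < ⊤)) :
    ∃ W : D.Weighting, W.IsTruthlySubstochastic ∧ ∀ q < 1, ∃ F : D.FiniteSubdigraph,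
      F.toDigraph.IsStrong ∧ q < W.finRoot F := by
  classical
  have hne : Nonempty V := by
    obtain ⟨c, -⟩ := exists_directedCycle_mul_card_le h 0 ∅
    exact ⟨c.vert 0⟩
  set x : ℕ → ℝ := fun n => 1 - 2⁻¹ ^ (n + 1) with hx
  have hpow : ∀ n : ℕ, (0 : ℝ) < 2⁻¹ ^ (n + 1) ∧ (2⁻¹ : ℝ) ^ (n + 1) < 1 := fun n =>
    ⟨by positivity, pow_lt_one₀ (by norm_num) (by norm_num) (Nat.succ_ne_zero n)⟩
  have hx0 : ∀ n, 0 < x n := fun n => sub_pos.2 (hpow n).2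
  have hx1 : ∀ n, x n < 1 := fun n => sub_lt_self _ (hpow n).1
  -- An arc at an old vertex will cost no more than `k` factors `x n`.
  have hk : ∀ n, ∃ k : ℕ, x n ^ k < 4⁻¹ ^ (n + 1) := fun n =>
    exists_pow_lt_of_lt_one (by positivity) (hx1 n)
  choose k hk using hk
  choose C hC using fun (n : ℕ) (U : Finset V) => exists_directedCycle_mul_card_le h (k n) U
  set U : ℕ → Finset V := fun n =>
    Nat.rec ∅ (fun n U => U ∪ Finset.univ.image (C n U).vert) n with hU
  have hUmem : ∀ n v, v ∈ U n ↔ ∃ m < n, v ∈ Set.range (C m (U m)).vert := by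
    intro n v
    induction n with
    | zero => simp [hU]
    | succ n ih =>
      have : U (n + 1) = U n ∪ Finset.univ.image (C n (U n)).vert := rfl
      rw [this, Finset.mem_union, ih, Finset.mem_image]
      simp only [Nat.lt_succ_iff_lt_or_eq, or_and_right, exists_or, exists_eq_left]
      simp
  obtain ⟨W, hW, hWc⟩ := exists_weighting_of_cycles fun n => C n (U n)
  refine ⟨W, hW, fun q hq => ?_⟩
  have hlim : Filter.Tendsto (fun n => x n ^ 2) Filter.atTop (nhds 1) := by
    have h1 : Filter.Tendsto (fun n : ℕ => (2⁻¹ : ℝ) ^ (n + 1)) Filter.atTop (nhds 0) :=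
      (tendsto_pow_atTop_nhds_zero_of_lt_one (by norm_num) (by norm_num)).comp
        (Filter.tendsto_add_atTop_nat 1)
    simpa [hx] using (h1.const_sub 1).pow 2
  obtain ⟨n, hn⟩ := (hlim.eventually (lt_mem_nhds hq)).exists
  set c := C n (U n)
  refine ⟨c.subdigraph, c.subdigraph_isStrong, hn.trans_le (c.le_finRoot_subdigraph hW.1 ?_)⟩
  have harc : ∀ i, x n * (if c.vert i ∈ U n then x n ^ k n else 1)
      ≤ W.adjMatrix (c.vert i) (c.vert (i + 1)) := by
    intro i
    refine le_trans ?_ (hWc n i)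
    by_cases hi : c.vert i ∈ U n
    · rw [if_pos hi, cycleArcWeight, if_pos ((hUmem _ _).1 hi)]
      refine (mul_le_of_le_one_left (by have := hx0 n; positivity) (hx1 n).le).trans ?_
      simpa using (hk n).le
    · rw [if_neg hi, cycleArcWeight, if_neg (mt (hUmem _ _).2 hi), mul_one,
        ENNReal.toReal_sub_of_le (pow_le_one₀ zero_le (by simp)) ENNReal.one_ne_top]
      simp [hx]
  refine le_trans ?_ (Finset.prod_le_prod (fun i _ => ?_) fun i _ => harc i)
  -- Old vertices contribute `x n ^ (k n * #old)`, at least `x n ^ c.length` by the choice of the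
  -- cycle; hence the exponent 2.
  · rw [Finset.prod_mul_distrib, Finset.prod_const, Finset.prod_ite, Finset.prod_const,
      Finset.prod_const_one, mul_one, ← pow_mul, Finset.card_univ, Fintype.card_fin, ← pow_mul,
      two_mul, pow_add]
    refine mul_le_mul_of_nonneg_left ?_ (by have := hx0 n; positivity)
    exact pow_le_pow_of_le_one (hx0 n).le (hx1 n).le (hC n (U n))
  · have := hx0 n
    split_ifs <;> positivity

end Digraph

/-! ### The equivalences -/

theorem proposition4 {V : Type*} [Countable V] (D : Digraph V) (hD : D.IsStrong) :
    ((∀ S : D.Weighting, S.IsTruthlySubstochastic →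
        0 < ⨅ F : D.FiniteSubdigraph, (1 - S.finRoot F)) ↔
      D.sctSize < ⊤ ∧ D.maxCycleLength < ⊤) ∧
    ((∀ S : D.Weighting, S.IsTruthlySubstochastic →
        0 < ⨅ F : {F : D.FiniteSubdigraph // F.toDigraph.IsStrong}, (1 - S.finRoot F)) ↔
      D.sctSize < ⊤ ∧ D.maxCycleLength < ⊤) ∧
    ((∀ S : D.Weighting, S.IsTruthlySubstochastic → S.supRoot < 1) ↔
      D.sctSize < ⊤ ∧ D.maxCycleLength < ⊤) := by
  have hone : ∀ S : D.Weighting, S.IsTruthlySubstochastic → ∀ F, S.finRoot F ≤ 1 := by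
    intro S hS F
    let _ : DecidableEq F.verts := fun a b => Classical.propDecidable (a = b)
    refine ENNReal.toReal_le_of_le_ofReal zero_le_one (iSup₂_le fun z hz => ?_)
    simpa using S.enorm_pow_le_of_mem_spectrum F hz (hS.1.survival_le_one 1)
  -- Boundedness below makes the real `⨅` a genuine infimum.
  have hbdd : ∀ S : D.Weighting, S.IsTruthlySubstochastic → ∀ F, 0 ≤ 1 - S.finRoot F :=
    fun S hS F => sub_nonneg.2 (hone S hS F)
  -- The empty subdigraph, vacuously strong, makes both index types nonempty, as `le_ciInf`
  -- requires.
  let E : D.FiniteSubdigraph := ⟨∅, fun _ _ => False, False.elim, False.elim, False.elim⟩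
  have hE : E.toDigraph.IsStrong := fun v => absurd v.2 (Finset.notMem_empty _)
  refine ⟨⟨fun h => ?_, fun h S hS => ?_⟩, ⟨fun h => ?_, fun h S hS => ?_⟩,
    ⟨fun h => ?_, fun h S hS => ?_⟩⟩
  · by_contra hno
    obtain ⟨W, hW, hq⟩ := Digraph.exists_weighting_finRoot_near_one hno
    obtain ⟨F, -, hF⟩ := hq _ (sub_lt_self 1 (h W hW))
    have := ciInf_le (f := fun F => 1 - W.finRoot F) ⟨0, by rintro _ ⟨F, rfl⟩; exact hbdd W hW F⟩ F
    linarith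
  · obtain ⟨r, hr, hF⟩ := hS.exists_finRoot_le hD h.1 h.2
    have : Nonempty D.FiniteSubdigraph := ⟨E⟩
    exact (sub_pos.2 hr).trans_le (le_ciInf fun F => sub_le_sub_left (hF F) 1)
  · by_contra hno
    obtain ⟨W, hW, hq⟩ := Digraph.exists_weighting_finRoot_near_one hno
    obtain ⟨F, hFs, hF⟩ := hq _ (sub_lt_self 1 (h W hW))
    have := ciInf_le (f := fun F : {F : D.FiniteSubdigraph // F.toDigraph.IsStrong} =>
      1 - W.finRoot F) ⟨0, by rintro _ ⟨F, rfl⟩; exact hbdd W hW F⟩ ⟨F, hFs⟩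
    simp only at this
    linarith
  · obtain ⟨r, hr, hF⟩ := hS.exists_finRoot_le hD h.1 h.2
    have : Nonempty {F : D.FiniteSubdigraph // F.toDigraph.IsStrong} := ⟨⟨E, hE⟩⟩
    exact (sub_pos.2 hr).trans_le (le_ciInf fun F => sub_le_sub_left (hF F) 1)
  · by_contra hno
    obtain ⟨W, hW, hq⟩ := Digraph.exists_weighting_finRoot_near_one hno
    have hlt := h W hW
    obtain ⟨F, hFs, hF⟩ := hq W.supRoot.toReal
      (by simpa using ENNReal.toReal_strict_mono ENNReal.one_ne_top hlt)
    have hle : ENNReal.ofReal (W.finRoot F) ≤ W.supRoot :=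
      le_iSup (fun F : {F : D.FiniteSubdigraph // F.toDigraph.IsStrong} =>
        ENNReal.ofReal (W.finRoot F)) ⟨F, hFs⟩
    have := (ENNReal.ofReal_le_iff_le_toReal hlt.ne_top).1 hle
    linarith
  · obtain ⟨r, hr, hF⟩ := hS.exists_finRoot_le hD h.1 h.2
    refine lt_of_le_of_lt (iSup_le fun F => ENNReal.ofReal_le_ofReal (hF F)) ?_
    simpa using hr
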